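/- There is an absolute constant $C>0$ such that for every integer $k\ge 1$ and all $\rho\in(0,1]$, $\varepsilon\in(0,1]$, $\delta\in(0,1)$ there exists a private-coin $\rho$-LDP protocol for $(k,\varepsilon,\delta)$-independence testing that uses one bit of communication per player and $$n\;\le\; C\,\frac{k^{3}}{\varepsilon^{2}\rho^{2}}\,\log\frac1\delta$$ players. Here $n$ players hold independent samples $X_1,\dots,X_n$ from an unknown distribution $\mathbf p$ on $[k]\times[k]$. In a private-coin $\rho$-LDP protocol with one bit per player, each player $i$ has a private random seed $U_i$ (the seeds are independent of one another and of the samples), selects as a function of $U_i$ a channel $W_i$ from $[k]\times[k]$ to $\{0,1\}$ that satisfies $W_i(y\mid x')\le e^{\rho}\,W_i(y\mid x)$ for all $y\in\{0,1\}$ and $x,x'\in[k]\times[k]$, and sends the referee the single bit $Y_i$ obtained by passing $X_i$ through $W_i$; all messages are sent simultaneously and there is no shared randomness. The protocol is for $(k,\varepsilon,\delta)$-independence testing if it comes with a (possibly randomized) map $\mathcal T\colon\{0,1\}^n\to\{0,1\}$ such that, for every distribution $\mathbf p$ on $[k]\times[k]$ with marginals $\mathbf p_1,\mathbf p_2$,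 $$\Pr[\mathcal T(Y_1,\dots,Y_n)=1]>1-\delta\quad\text{if }\mathbf p=\mathbf p_1\otimes\mathbf p_2,$$ $$\Pr[\mathcal T(Y_1,\dots,Y_n)=0]>1-\delta\quad\text{if }\inf_{\mathbf q_1,\mathbf q_2} d_{\mathrm{TV}}(\mathbf p,\mathbf q_1\otimes\mathbf q_2)>\varepsilon,$$ where the infimum is over all distributions $\mathbf q_1,\mathbf q_2$ on $[k]$ and $d_{\mathrm{TV}}(\mathbf p,\mathbf q)=\frac12\sum_x|\mathbf p(x)-\mathbf q(x)|$. -/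

import Mathlib

open MeasureTheory ProbabilityTheory

noncomputable section

namespace LDPTesting

/-- Total variation distance of two distributions on a finite domain: half the `ℓ₁` distance of
the probability mass functions. -/
def tvDist {X : Type*} [Fintype X] [MeasurableSpace X] (p q : Measure X) : ℝ :=
  (1 / 2) * ∑ x, |p.real {x} - q.real {x}|

/-- The total variation distance of `p` from the set of all product distributions on
`[k] × [k]`. -/
def distToProducts (k : ℕ) (p : Measure (Fin k × Fin k)) : ℝ :=
  ⨅ q : ProbabilityMeasure (Fin k) × ProbabilityMeasure (Fin k),
    tvDist p ((q.1 : Measure (Fin k)).prod (q.2 : Measure (Fin k)))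

/-- A channel `W` from the data domain `X` to the (discrete) message set `Y` is `ρ`-locally
differentially private: `W(y | x') ≤ e ^ ρ * W(y | x)` for every message and all inputs. -/
def IsLDPChannel {X Y : Type*} [MeasurableSpace X] [MeasurableSpace Y]
    (ρ : ℝ) (W : Kernel X Y) : Prop :=
  ∀ (y : Y) (x x' : X), W x' {y} ≤ ENNReal.ofReal (Real.exp ρ) * W x {y}

/-- A private-coin simultaneous-message-passing protocol with `n` players, data domain `X` and
message set `Y`. Player `i` has a private seed `Uᵢ` with law `seedLaw i`, and passes the sample
through the channel selected by that seed; `channel i (u, x)` is the law of the message of player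
`i` on seed `u` and sample `x`. -/
structure PrivateCoinProtocol (X Y : Type) [MeasurableSpace X] [MeasurableSpace Y] (n : ℕ) where
  Seed : Fin n → Type
  seedSpace : ∀ i, MeasurableSpace (Seed i)
  seedLaw : ∀ i, Measure (Seed i)
  seedLaw_prob : ∀ i, IsProbabilityMeasure (seedLaw i)
  channel : ∀ i, Kernel (Seed i × X) Y
  channel_markov : ∀ i, IsMarkovKernel (channel i)

namespace PrivateCoinProtocol

variable {X Y : Type} [MeasurableSpace X] [MeasurableSpace Y] {n : ℕ}

attribute [instance] seedSpace seedLaw_prob channel_markov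

/-- The channel which player `i` selects when the private seed is `u`. -/
def channelAt (π : PrivateCoinProtocol X Y n) (i : Fin n) (u : π.Seed i) : Kernel X Y :=
  (π.channel i).comap (fun x => (u, x)) measurable_prodMk_left

/-- Whatever the private seeds are, every player selects a `ρ`-LDP channel. -/
def IsLDP (π : PrivateCoinProtocol X Y n) (ρ : ℝ) : Prop :=
  ∀ (i : Fin n) (u : π.Seed i), IsLDPChannel ρ (π.channelAt i u)

/-- The law of the message of player `i`, whose sample `Xᵢ ∼ p` is independent of the
private seed. -/
def messageLaw (π : PrivateCoinProtocol X Y n) (p : Measure X) (i : Fin n) : Measure Y :=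
  ((π.seedLaw i).prod p).bind (π.channel i)

/-- The joint law of the messages `(Y₁, …, Yₙ)` received by the referee. The pairs `(Uᵢ, Xᵢ)` are
independent across players and each message is a randomized function of its own pair, so the
messages are independent. -/
def transcriptLaw (π : PrivateCoinProtocol X Y n) (p : Measure X) : Measure (Fin n → Y) :=
  Measure.pi fun i => π.messageLaw p i

/-- The law of the referee's verdict when the randomized map `T` is applied to the messages
(`true` is accept, that is `1`, and `false` is reject, that is `0`). -/
def verdictLaw (π : PrivateCoinProtocol X Y n) (T : Kernel (Fin n → Y) Bool) (p : Measure X) :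
    Measure Bool :=
  (π.transcriptLaw p).bind T

instance (π : PrivateCoinProtocol X Y n) (p : Measure X) [IsProbabilityMeasure p] (i : Fin n) :
    IsProbabilityMeasure (π.messageLaw p i) := by
  unfold messageLaw; infer_instance

instance (π : PrivateCoinProtocol X Y n) (p : Measure X) [IsProbabilityMeasure p] :
    IsProbabilityMeasure (π.transcriptLaw p) := by
  unfold transcriptLaw; infer_instance

instance (π : PrivateCoinProtocol X Y n) (T : Kernel (Fin n → Y) Bool) [IsMarkovKernel T]
    (p : Measure X) [IsProbabilityMeasure p] : IsProbabilityMeasure (π.verdictLaw T p) := by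
  unfold verdictLaw; infer_instance

end PrivateCoinProtocol

/-- The protocol `π` with the referee's randomized map `T` solves `(k, ε, δ)`-independence
testing: it accepts every product distribution, and rejects every distribution that is `ε`-far
from all product distributions, in both cases with probability greater than `1 - δ`. -/
def SolvesIndependenceTesting {Y : Type} [MeasurableSpace Y] {n : ℕ} (k : ℕ) (ε δ : ℝ)
    (π : PrivateCoinProtocol (Fin k × Fin k) Y n) (T : Kernel (Fin n → Y) Bool) : Prop :=
  ∀ (p : Measure (Fin k × Fin k)) [IsProbabilityMeasure p],
    (p = p.fst.prod p.snd → 1 - δ < (π.verdictLaw T p).real {true}) ∧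
    (ε < distToProducts k p → 1 - δ < (π.verdictLaw T p).real {false})

end LDPTesting

end

/-! Pick `L = 2 ^ q` between `k` and `2 * k` and embed `[k]` into the group `(ℤ/2)^q`, so that the
`L` Walsh characters `h a` form a sign system with orthogonal columns. Let `P (a, b)`, `u a`, `v b`
be the means of `h a x₁ * h b x₂`, `h a x₁`, `h b x₂`. By Parseval (`sum_coeff_sub_sq`), `A = ∑ (P
(a, b) - u a * v b) ^ 2` equals `L ^ 2` times the squared `ℓ₂` distance between `p` and the product
of its marginals. So `A = 0` under independence, while Cauchy-Schwarz gives `A ≥ 4 * ε ^ 2` in the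
far case (`four_mul_sq_le_of_lt_distToProducts`).

Each player is assigned one such sign function and sends a bit whose sign has mean `ρ / 4` times its
value, which is `ρ`-LDP. A block has four kinds of players: two independent groups estimate `P`, one
estimates `u`, one estimates `v`. Each joint coefficient gets `m` players per group, each marginal
one `L * m`. `A` is estimated by `∑ (P̂ - û v̂) * (P̂' - û v̂)`; using two independent copies of
`P̂` removes the bias of its squared noise. `integral_abs_blockStatistic_sub_le` shows that `m` of
order `L / (ρ ^ 2 * ε ^ 2)` suffices, so a block has `4 * L ^ 2 * m`, of order `k ^ 3 / (ρ ^ 2 * ε ^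
2)`, players. A block errs with probability at most `1 / 16`, and a majority vote over order `log (1
/ δ)` blocks (`measureReal_half_le`) brings the error below `δ`. -/

namespace LDPTesting

/-- The mean over the replicas `t` of the centred variables `z (a, t)`. -/
noncomputable def meanNoise {I A R : Type*} [Fintype R] (e : A × R → I) (z : A × R → Bool → ℝ) (a : A)
    (ω : I → Bool) : ℝ :=
  (∑ t, z (a, t) (ω (e (a, t)))) / Fintype.card R

lemma dependsOn_meanNoise {I A R : Type*} [Fintype R] (e : A × R → I) (z : A × R → Bool → ℝ) (a : A) :
    DependsOn (meanNoise e z a) (Set.range e) := by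
  intro x y h
  have h1 : ∀ t, x (e (a, t)) = y (e (a, t)) := fun t => h _ ⟨_, rfl⟩
  simp [meanNoise, h1]

/-! ### Second moments of independent centred noise -/

section Independence

variable {I : Type*} [Fintype I] {μ : I → Measure Bool} [∀ i, IsProbabilityMeasure (μ i)]

/-- Functions of disjoint sets of coordinates are uncorrelated under a product measure. -/
lemma integral_mul_of_dependsOn {F G : (I → Bool) → ℝ} {S T : Set I}
    (hF : DependsOn F S) (hG : DependsOn G T) (hST : Disjoint S T) :
    ∫ ω, F ω * G ω ∂Measure.pi μ = (∫ ω, F ω ∂Measure.pi μ) * ∫ ω, G ω ∂Measure.pi μ := by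
  classical
  have hind : iIndepFun (fun (i : I) (ω : I → Bool) => ω i) (Measure.pi μ) :=
    iIndepFun_pi (X := fun _ b => b) fun _ => aemeasurable_id
  have h := hind.indepFun_finset (S := S.toFinset) (T := T.toFinset)
    (by simpa using hST) (fun i => measurable_pi_apply i)
  -- The filler `true` off `S` is harmless, since `F` ignores those coordinates.
  let F' : (S.toFinset → Bool) → ℝ := fun r => F fun i => if h : i ∈ S.toFinset then r ⟨i, h⟩ else true
  let G' : (T.toFinset → Bool) → ℝ := fun r => G fun i => if h : i ∈ T.toFinset then r ⟨i, h⟩ else true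
  have h2 := (h.comp (Measurable.of_discrete (f := F'))
    (Measurable.of_discrete (f := G'))).integral_fun_mul_eq_mul_integral
      (Integrable.of_finite.aestronglyMeasurable) (Integrable.of_finite.aestronglyMeasurable)
  have eF : F = F' ∘ (fun a (i : S.toFinset) => a i) := by
    funext ω
    exact hF fun i hi => by simp [hi]
  have eG : G = G' ∘ (fun a (i : T.toFinset) => a i) := by
    funext ω
    exact hG fun i hi => by simp [hi]
  rw [← eF, ← eG] at h2
  exact h2

lemma integral_prod_of_dependsOn {J : Type*} (s : Finset J) {F : J → (I → Bool) → ℝ}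
    {S : J → Set I} (hF : ∀ j, DependsOn (F j) (S j)) (hS : Pairwise fun i j => Disjoint (S i) (S j)) :
    ∫ ω, ∏ j ∈ s, F j ω ∂Measure.pi μ = ∏ j ∈ s, ∫ ω, F j ω ∂Measure.pi μ := by
  classical
  induction s using Finset.induction_on with
  | empty => simp
  | insert j s hj ih =>
    simp_rw [Finset.prod_insert hj]
    rw [← ih]
    refine integral_mul_of_dependsOn (hF j) (T := ⋃ i ∈ s, S i) ?_ ?_
    · intro x y hxy
      refine Finset.prod_congr rfl fun i hi => hF i fun l hl => hxy l ?_
      simp only [Set.mem_iUnion]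
      exact ⟨i, hi, hl⟩
    · simp only [Set.disjoint_iUnion_right]
      intro i hi
      exact hS fun h => hj (h ▸ hi)

/-- The second moment of a linear form in independent centred variables, whose coefficients are
functions of the other coordinates. -/
lemma integral_sq_sum_le {J : Type*} [Fintype J] {e : J → I} (he : e.Injective)
    {z : J → Bool → ℝ} {s : ℝ} (hz : ∀ j, ∫ b, z j b ∂μ (e j) = 0)
    (hs : ∀ j, ∫ b, z j b ^ 2 ∂μ (e j) ≤ s) {V : J → (I → Bool) → ℝ}
    (hV : ∀ j, DependsOn (V j) (Set.range e)ᶜ) :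
    ∫ ω, (∑ j, V j ω * z j (ω (e j))) ^ 2 ∂Measure.pi μ ≤
      s * ∑ j, ∫ ω, V j ω ^ 2 ∂Measure.pi μ := by
  classical
  have heval : ∀ (j : J) (g : Bool → ℝ),
      ∫ ω : I → Bool, g (ω (e j)) ∂Measure.pi μ = ∫ b, g b ∂μ (e j) := fun j g =>
    integral_comp_eval (μ := μ) (i := e j) (f := g) Integrable.of_finite.aestronglyMeasurable
  have hcoord : ∀ (j : J) (g : Bool → ℝ), DependsOn (fun ω : I → Bool => g (ω (e j))) {e j} :=
    fun j g x y h => by simp [h (e j) rfl]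
  -- Cross terms vanish: `z j` is centred and the other three factors do not see the coordinate `e
  -- j`.
  have hoff : ∀ i j, i ≠ j → ∫ ω, (V i ω * z i (ω (e i))) * (V j ω * z j (ω (e j)))
      ∂Measure.pi μ = 0 := by
    intro i j hij
    have := integral_mul_of_dependsOn (μ := μ)
      (F := fun ω => V i ω * z i (ω (e i)) * V j ω) (S := {e j}ᶜ) ?_ (hcoord j (z j))
      disjoint_compl_left
    · rw [heval, hz, mul_zero] at this
      rw [← this]
      congr 1; ext ω; ring
    · intro x y h
      have h1 : V i x = V i y := hV i fun l hl => h l fun hl' => hl ⟨j, hl'.symm⟩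
      have h2 : V j x = V j y := hV j fun l hl => h l fun hl' => hl ⟨j, hl'.symm⟩
      have h3 : x (e i) = y (e i) := h _ fun h' => hij (he h')
      simp [h1, h2, h3]
  have hdiag : ∀ j, ∫ ω, (V j ω * z j (ω (e j))) * (V j ω * z j (ω (e j)))
      ∂Measure.pi μ ≤ s * ∫ ω, V j ω ^ 2 ∂Measure.pi μ := by
    intro j
    have := integral_mul_of_dependsOn (μ := μ)
      (F := fun ω => V j ω ^ 2) (S := {e j}ᶜ) ?_ (hcoord j fun b => z j b ^ 2)
      disjoint_compl_left
    · rw [heval j fun b => z j b ^ 2] at this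
      calc _ = ∫ ω, V j ω ^ 2 * z j (ω (e j)) ^ 2 ∂Measure.pi μ := by
            congr 1; ext ω; ring
        _ = _ := this
        _ ≤ (∫ ω, V j ω ^ 2 ∂Measure.pi μ) * s :=
          mul_le_mul_of_nonneg_left (hs j) (integral_nonneg fun ω => sq_nonneg _)
        _ = _ := mul_comm _ _
    · intro x y h
      have h2 : V j x = V j y := hV j fun l hl => h l fun hl' => hl ⟨j, hl'.symm⟩
      simp [h2]
  simp_rw [sq (∑ j, _), Finset.sum_mul_sum]
  rw [integral_finsetSum _ fun _ _ => Integrable.of_finite, Finset.mul_sum]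
  refine Finset.sum_le_sum fun j _ => ?_
  rw [integral_finsetSum _ fun _ _ => Integrable.of_finite, Finset.sum_eq_single j]
  · exact hdiag j
  · exact fun i _ hi => hoff j i hi.symm
  · simp

variable {A R : Type*} [Fintype A] [Fintype R] [Nonempty R] {e : A × R → I} {z : A × R → Bool → ℝ}
  {s : ℝ}

lemma integral_sq_sum_meanNoise_le (he : e.Injective) (hz : ∀ j, ∫ b, z j b ∂μ (e j) = 0)
    (hs : ∀ j, ∫ b, z j b ^ 2 ∂μ (e j) ≤ s) {V : A → (I → Bool) → ℝ}
    (hV : ∀ a, DependsOn (V a) (Set.range e)ᶜ) :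
    ∫ ω, (∑ a, V a ω * meanNoise e z a ω) ^ 2 ∂Measure.pi μ ≤
      s / Fintype.card R * ∑ a, ∫ ω, V a ω ^ 2 ∂Measure.pi μ := by
  have hr : (Fintype.card R : ℝ) ≠ 0 := by
    exact_mod_cast Fintype.card_ne_zero
  have h := integral_sq_sum_le (μ := μ) he hz hs
    (V := fun j ω => V j.1 ω / Fintype.card R) fun j x y h => by simp [hV j.1 h]
  simp only [Fintype.sum_prod_type] at h
  convert h using 1
  · congr 1; ext ω
    congr 1
    refine Finset.sum_congr rfl fun a _ => ?_
    rw [meanNoise, Finset.sum_div, Finset.mul_sum]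
    exact Finset.sum_congr rfl fun t _ => by ring
  · simp only [div_pow, integral_div, Finset.sum_const, Finset.card_univ, nsmul_eq_mul]
    rw [Finset.mul_sum, Finset.mul_sum]
    refine Finset.sum_congr rfl fun a _ => ?_
    field_simp

/-- The case of a single nonzero weight; it controls products of noises from disjoint groups of
players. -/
lemma integral_sq_mul_meanNoise_le (he : e.Injective) (hz : ∀ j, ∫ b, z j b ∂μ (e j) = 0)
    (hs : ∀ j, ∫ b, z j b ^ 2 ∂μ (e j) ≤ s) {F : (I → Bool) → ℝ}
    (hF : DependsOn F (Set.range e)ᶜ) (a : A) :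
    ∫ ω, F ω ^ 2 * meanNoise e z a ω ^ 2 ∂Measure.pi μ ≤
      s / Fintype.card R * ∫ ω, F ω ^ 2 ∂Measure.pi μ := by
  classical
  have h := integral_sq_sum_meanNoise_le (μ := μ) he hz hs
    (V := fun a' ω => if a' = a then F ω else 0) fun a' x y h => by simp [hF h]
  rw [Finset.sum_eq_single a (fun b _ hb => by simp [hb]) (by simp)] at h
  simpa [mul_pow] using h

end Independence

/-- Here `D` is the signal, `η` the error shared by both factors, and `ξ`, `ξ'` the independent
noises. Weighted AM-GM charges `B / 64` to the cross term of `D` and `η` and `B / 128` to the terms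
with `ξ`, `ξ'`, leaving only squares, whose expectations are accessible. The sign `σ` treats both
sides of the absolute value at once. -/
lemma abs_sum_mul_sub_sum_sq_le {A : Type*} [Fintype A] (D η ξ ξ' : A → ℝ) {B : ℝ} (hB : 0 < B)
    (hD : ∑ a, D a ^ 2 ≤ B) :
    |∑ a, (D a + η a + ξ a) * (D a + η a + ξ' a) - ∑ a, D a ^ 2| ≤
      3 / 128 * B + 96 / B * ((∑ a, (D a + η a) * ξ a) ^ 2 + (∑ a, (D a + η a) * ξ' a) ^ 2 +
        (∑ a, ξ' a * ξ a) ^ 2) + 65 * ∑ a, η a ^ 2 := by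
  set x := ∑ a, (D a + η a) * ξ a
  set y := ∑ a, (D a + η a) * ξ' a
  set w := ∑ a, ξ' a * ξ a
  set h := ∑ a, η a ^ 2
  set c := ∑ a, D a * η a
  have e1 : ∑ a, (D a + η a + ξ a) * (D a + η a + ξ' a) - ∑ a, D a ^ 2
      = (x + y + w) + 2 * c + h := by
    simp only [x, y, w, h, c, Finset.mul_sum, ← Finset.sum_add_distrib, ← Finset.sum_sub_distrib]
    exact Finset.sum_congr rfl fun a _ => by ring
  have hc : ∀ σ : ℝ, σ ^ 2 = 1 → 2 * (σ * c) ≤ 1 / 64 * B + 64 * h := by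
    intro σ hσ
    have : 0 ≤ ∑ a, (1 / 8 * σ * D a - 8 * η a) ^ 2 := Finset.sum_nonneg fun a _ => sq_nonneg _
    have e2 : ∑ a, (1 / 8 * σ * D a - 8 * η a) ^ 2
        = 1 / 64 * ∑ a, D a ^ 2 - 2 * (σ * c) + 64 * h := by
      simp only [h, c, Finset.mul_sum, ← Finset.sum_add_distrib, ← Finset.sum_sub_distrib]
      refine Finset.sum_congr rfl fun a _ => ?_
      linear_combination (1 / 64 * D a ^ 2) * hσ
    linarith
  have hN : ∀ σ : ℝ, σ ^ 2 = 1 →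
      σ * (x + y + w) ≤ 1 / 128 * B + 96 / B * (x ^ 2 + y ^ 2 + w ^ 2) := by
    intro σ hσ
    have h3 : (x + y + w) ^ 2 ≤ 3 * (x ^ 2 + y ^ 2 + w ^ 2) := by
      nlinarith [sq_nonneg (x - y), sq_nonneg (y - w), sq_nonneg (x - w)]
    have h4 : σ * (x + y + w) ≤ 1 / 128 * B + 32 / B * (x + y + w) ^ 2 := by
      have : 1 / 128 * B + 32 / B * (x + y + w) ^ 2 - σ * (x + y + w)
          = (1 / 128) / B * (B - 64 * σ * (x + y + w)) ^ 2 := by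
        field_simp
        linear_combination (-(x + y + w) ^ 2 * 4096) * hσ
      have : 0 ≤ (1 / 128) / B * (B - 64 * σ * (x + y + w)) ^ 2 := by positivity
      linarith
    have h5 : 32 / B * (x + y + w) ^ 2 ≤ 32 / B * (3 * (x ^ 2 + y ^ 2 + w ^ 2)) := by gcongr
    have h6 : 32 / B * (3 * (x ^ 2 + y ^ 2 + w ^ 2)) = 96 / B * (x ^ 2 + y ^ 2 + w ^ 2) := by ring
    linarith
  have hh : 0 ≤ h := Finset.sum_nonneg fun a _ => sq_nonneg _
  rw [e1, abs_le]
  have := hc 1 (by norm_num); have := hc (-1) (by norm_num)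
  have := hN 1 (by norm_num); have := hN (-1) (by norm_num)
  constructor <;> linarith

/-! ### Error of one block of players -/

section Block

variable {I ι : Type*} [Fintype I] [Fintype ι] [Nonempty ι] {m : ℕ} [NeZero m]
  {μ : I → Measure Bool} [∀ i, IsProbabilityMeasure (μ i)]
  {e : Fin 4 × ι × ι × Fin m → I} {z : Fin 4 × ι × ι × Fin m → Bool → ℝ} {s : ℝ}

/-- The noise of the estimates of the joint coefficients, one for each pair of frequencies. -/
noncomputable def jointNoise (e : Fin 4 × ι × ι × Fin m → I)
    (z : Fin 4 × ι × ι × Fin m → Bool → ℝ) (c : Fin 4) (a : ι × ι) (ω : I → Bool) : ℝ :=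
  meanNoise (fun j : (ι × ι) × Fin m => e (c, j.1.1, j.1.2, j.2))
    (fun j => z (c, j.1.1, j.1.2, j.2)) a ω

/-- The noise of the estimates of the marginal coefficients, one for each frequency. -/
noncomputable def marginalNoise (e : Fin 4 × ι × ι × Fin m → I)
    (z : Fin 4 × ι × ι × Fin m → Bool → ℝ) (c : Fin 4) (a : ι) (ω : I → Bool) : ℝ :=
  meanNoise (fun j : ι × ι × Fin m => e (c, j)) (fun j => z (c, j)) a ω

omit [Fintype I] [Fintype ι] [Nonempty ι] [NeZero m] in
lemma dependsOn_jointNoise (c : Fin 4) (a : ι × ι) :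
    DependsOn (jointNoise e z c a) (Set.range fun j => e (c, j)) :=
  (dependsOn_meanNoise _ _ a).mono (by rintro _ ⟨j, rfl⟩; exact ⟨_, rfl⟩)

omit [Fintype I] [Nonempty ι] [NeZero m] in
lemma dependsOn_marginalNoise (c : Fin 4) (a : ι) :
    DependsOn (marginalNoise e z c a) (Set.range fun j => e (c, j)) :=
  dependsOn_meanNoise _ _ a

omit [Fintype I] [Fintype ι] [Nonempty ι] [NeZero m] in
lemma range_subset_compl_range (he : e.Injective) {c c' : Fin 4} (h : c ≠ c') :
    (Set.range fun j => e (c, j)) ⊆ (Set.range fun j => e (c', j))ᶜ := by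
  rintro _ ⟨j, rfl⟩ ⟨j', hj⟩
  exact h (congrArg Prod.fst (he hj)).symm

omit [Nonempty ι] in
lemma integral_sq_sum_jointNoise_le (he : e.Injective) (hz : ∀ j, ∫ b, z j b ∂μ (e j) = 0)
    (hs : ∀ j, ∫ b, z j b ^ 2 ∂μ (e j) ≤ s) (c : Fin 4) {V : ι × ι → (I → Bool) → ℝ}
    (hV : ∀ a, DependsOn (V a) (Set.range fun j => e (c, j))ᶜ) :
    ∫ ω, (∑ a, V a ω * jointNoise e z c a ω) ^ 2 ∂Measure.pi μ ≤
      s / m * ∑ a, ∫ ω, V a ω ^ 2 ∂Measure.pi μ := by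
  have := integral_sq_sum_meanNoise_le (μ := μ)
    (e := fun j : (ι × ι) × Fin m => e (c, j.1.1, j.1.2, j.2))
    (z := fun j => z (c, j.1.1, j.1.2, j.2)) (s := s) (V := V) ?_ (fun j => hz _) (fun j => hs _)
    fun a => (hV a).mono (by
      apply Set.compl_subset_compl.2
      rintro _ ⟨j, rfl⟩
      exact ⟨_, rfl⟩)
  · simpa [jointNoise] using this
  · rintro ⟨⟨a, b⟩, t⟩ ⟨⟨a', b'⟩, t'⟩ h
    have := he h
    simp only [Prod.mk.injEq] at this ⊢
    tauto

omit [Nonempty ι] in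
lemma integral_jointNoise_sq_le (he : e.Injective) (hz : ∀ j, ∫ b, z j b ∂μ (e j) = 0)
    (hs : ∀ j, ∫ b, z j b ^ 2 ∂μ (e j) ≤ s) (c : Fin 4) (a : ι × ι) :
    ∫ ω, jointNoise e z c a ω ^ 2 ∂Measure.pi μ ≤ s / m := by
  classical
  have := integral_sq_sum_jointNoise_le he hz hs c (V := fun a' _ => if a' = a then 1 else 0)
    fun a' _ _ _ => rfl
  simpa using this

lemma integral_sq_mul_marginalNoise_le (he : e.Injective) (hz : ∀ j, ∫ b, z j b ∂μ (e j) = 0)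
    (hs : ∀ j, ∫ b, z j b ^ 2 ∂μ (e j) ≤ s) (c : Fin 4) {F : (I → Bool) → ℝ}
    (hF : DependsOn F (Set.range fun j => e (c, j))ᶜ) (a : ι) :
    ∫ ω, F ω ^ 2 * marginalNoise e z c a ω ^ 2 ∂Measure.pi μ ≤
      s / (Fintype.card ι * m) * ∫ ω, F ω ^ 2 ∂Measure.pi μ := by
  have := integral_sq_mul_meanNoise_le (μ := μ) (e := fun j : ι × ι × Fin m => e (c, j))
    (z := fun j => z (c, j)) (s := s) (fun i j h => by simpa using he h)
    (fun j => hz _) (fun j => hs _) hF a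
  simpa [marginalNoise] using this

lemma integral_marginalNoise_sq_le (he : e.Injective) (hz : ∀ j, ∫ b, z j b ∂μ (e j) = 0)
    (hs : ∀ j, ∫ b, z j b ^ 2 ∂μ (e j) ≤ s) (c : Fin 4) (a : ι) :
    ∫ ω, marginalNoise e z c a ω ^ 2 ∂Measure.pi μ ≤ s / (Fintype.card ι * m) := by
  have := integral_sq_mul_marginalNoise_le he hz hs c (F := fun _ => 1) (fun _ _ _ => rfl) a
  simpa using this

/-- The error of the product of the marginal estimates. -/
noncomputable def productError (e : Fin 4 × ι × ι × Fin m → I)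
    (z : Fin 4 × ι × ι × Fin m → Bool → ℝ) (u v : ι → ℝ) (a : ι × ι) (ω : I → Bool) : ℝ :=
  u a.1 * v a.2 - (u a.1 + marginalNoise e z 2 a.1 ω) * (v a.2 + marginalNoise e z 3 a.2 ω)

/-- With marginal noises `ν`, `ν'`, the error is `-(u * ν' + v * ν + ν * ν')`. Each of the three
squares sums to at most `L ^ 2 * κ` in expectation, the last because kinds 2 and 3 are disjoint and
`κ ≤ 1`; `(x + y + z) ^ 2 ≤ 3 * (x ^ 2 + y ^ 2 + z ^ 2)` makes this 9. -/
lemma sum_integral_productError_sq_le (he : e.Injective) (hz : ∀ j, ∫ b, z j b ∂μ (e j) = 0)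
    (hs : ∀ j, ∫ b, z j b ^ 2 ∂μ (e j) ≤ s) {u v : ι → ℝ} {κ : ℝ}
    (hκ : s / (Fintype.card ι * m) = κ) (hκ0 : 0 ≤ κ) (hκ1 : κ ≤ 1)
    (hu : ∑ a, u a ^ 2 ≤ Fintype.card ι) (hv : ∑ a, v a ^ 2 ≤ Fintype.card ι) :
    ∑ a, ∫ ω, productError e z u v a ω ^ 2 ∂Measure.pi μ ≤ 9 * (Fintype.card ι ^ 2 * κ) := by
  set L : ℝ := ((Fintype.card ι : ℕ) : ℝ)
  have hL : 0 ≤ L := by positivity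
  have hterm : ∀ a : ι × ι, ∫ ω, productError e z u v a ω ^ 2 ∂Measure.pi μ ≤
      3 * (u a.1 ^ 2 * κ + v a.2 ^ 2 * κ + κ ^ 2) := by
    intro a
    set ν := marginalNoise e z 2 a.1
    set ν' := marginalNoise e z 3 a.2
    have h1 : ∫ ω, ν ω ^ 2 ∂Measure.pi μ ≤ κ := hκ ▸ integral_marginalNoise_sq_le he hz hs 2 a.1
    have h2 : ∫ ω, ν' ω ^ 2 ∂Measure.pi μ ≤ κ := hκ ▸ integral_marginalNoise_sq_le he hz hs 3 a.2
    have h3 : ∫ ω, ν ω ^ 2 * ν' ω ^ 2 ∂Measure.pi μ ≤ κ ^ 2 := by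
      have := integral_sq_mul_marginalNoise_le (μ := μ) he hz hs 3 (F := ν)
        ((dependsOn_marginalNoise 2 a.1).mono (range_subset_compl_range he (by decide))) a.2
      rw [hκ] at this
      exact this.trans (by rw [sq]; exact mul_le_mul_of_nonneg_left h1 hκ0)
    calc ∫ ω, productError e z u v a ω ^ 2 ∂Measure.pi μ
        ≤ ∫ ω, 3 * (u a.1 ^ 2 * ν' ω ^ 2 + v a.2 ^ 2 * ν ω ^ 2 + ν ω ^ 2 * ν' ω ^ 2)
            ∂Measure.pi μ := by
          refine integral_mono .of_finite .of_finite fun ω => ?_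
          simp only [productError]
          change (u a.1 * v a.2 - (u a.1 + ν ω) * (v a.2 + ν' ω)) ^ 2 ≤ _
          nlinarith [sq_nonneg (u a.1 * ν' ω - v a.2 * ν ω), sq_nonneg (u a.1 * ν' ω - ν ω * ν' ω),
            sq_nonneg (v a.2 * ν ω - ν ω * ν' ω)]
      _ = 3 * (u a.1 ^ 2 * ∫ ω, ν' ω ^ 2 ∂Measure.pi μ + v a.2 ^ 2 * ∫ ω, ν ω ^ 2 ∂Measure.pi μ +
            ∫ ω, ν ω ^ 2 * ν' ω ^ 2 ∂Measure.pi μ) := by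
          rw [integral_const_mul, integral_add .of_finite .of_finite,
            integral_add .of_finite .of_finite, integral_const_mul, integral_const_mul]
      _ ≤ _ := by gcongr
  refine (Finset.sum_le_sum fun a _ => hterm a).trans ?_
  have e1 : ∑ a : ι × ι, 3 * (u a.1 ^ 2 * κ + v a.2 ^ 2 * κ + κ ^ 2)
      = 3 * (L * κ * ∑ a, u a ^ 2 + L * κ * ∑ a, v a ^ 2 + L ^ 2 * κ ^ 2) := by
    simp only [← Finset.mul_sum, Finset.sum_add_distrib, Fintype.sum_prod_type, Finset.sum_const,
      Finset.card_univ, nsmul_eq_mul, ← Finset.sum_mul]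
    rw [Fintype.card_prod, Nat.cast_mul]
    simp only [L]
    ring
  rw [e1]
  have h1 : L * κ * ∑ a, u a ^ 2 ≤ L * κ * L := by gcongr
  have h2 : L * κ * ∑ a, v a ^ 2 ≤ L * κ * L := by gcongr
  have h3 : L ^ 2 * κ ^ 2 ≤ L ^ 2 * κ := by
    have : κ ^ 2 ≤ κ := by nlinarith
    gcongr
  nlinarith

/-- With `w = s / m`, the shared error contributes `O(L * w)`, the forms linear in one joint noise
have second moment `O(w * (B + L * w))`, and the product of the two joint noises has second moment
`(L * w) ^ 2`. All are small against `B` as soon as `L * w` is a small multiple of `g`. -/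
lemma integral_abs_blockStatistic_sub_le (he : e.Injective) (hz : ∀ j, ∫ b, z j b ∂μ (e j) = 0)
    (hs : ∀ j, ∫ b, z j b ^ 2 ∂μ (e j) ≤ s) (hs0 : 0 ≤ s) {P : ι × ι → ℝ} {u v : ι → ℝ}
    (hu : ∑ a, u a ^ 2 ≤ Fintype.card ι) (hv : ∑ a, v a ^ 2 ≤ Fintype.card ι)
    {g B : ℝ} (hg : 0 < g) (hg1 : g ≤ 1) (hm : 40000 * (Fintype.card ι * (s / m)) ≤ g)
    (hgB : 4 * g ≤ B) (hB : ∑ a, (P a - u a.1 * v a.2) ^ 2 ≤ B) :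
    ∫ ω, |∑ a, (P a + jointNoise e z 0 a ω -
          (u a.1 + marginalNoise e z 2 a.1 ω) * (v a.2 + marginalNoise e z 3 a.2 ω)) *
        (P a + jointNoise e z 1 a ω -
          (u a.1 + marginalNoise e z 2 a.1 ω) * (v a.2 + marginalNoise e z 3 a.2 ω)) -
        ∑ a, (P a - u a.1 * v a.2) ^ 2| ∂Measure.pi μ ≤ B / 32 := by
  set L : ℝ := ((Fintype.card ι : ℕ) : ℝ)
  have hL1 : (1 : ℝ) ≤ L := by
    have : 1 ≤ Fintype.card ι := Fintype.card_pos
    simpa only [L, Nat.one_le_cast] using this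
  have hm0 : (0 : ℝ) < m := by
    exact_mod_cast Nat.pos_of_ne_zero (NeZero.ne m)
  have hB0 : 0 < B := by linarith
  set D : ι × ι → ℝ := fun a => P a - u a.1 * v a.2
  set η := productError e z u v
  set ξ := jointNoise e z 0
  set ξ' := jointNoise e z 1
  set V : ι × ι → (I → Bool) → ℝ := fun a ω => D a + η a ω
  set H := ∑ a, ∫ ω, η a ω ^ 2 ∂Measure.pi μ
  set w := s / m
  have hw0 : 0 ≤ w := by positivity
  have hκ : s / (L * m) = w / L := by
    simp only [w]; field_simp
  have hwL : w ≤ L * w := by nlinarith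
  have hκ1 : w / L ≤ 1 := by
    rw [div_le_one (by linarith)]; linarith
  have hH : H ≤ 9 * (L * w) := by
    have := sum_integral_productError_sq_le he hz hs hκ (by positivity) hκ1 hu hv
    refine this.trans (le_of_eq ?_)
    change 9 * (L ^ 2 * (w / L)) = _
    field_simp
  -- The shared error involves only kinds 2 and 3, so it can serve as a weight for the noise of
  -- kinds 0 and 1.
  have hη : ∀ a (c : Fin 4), c ≠ 2 → c ≠ 3 → DependsOn (η a) (Set.range fun j => e (c, j))ᶜ := by
    intro a c h2 h3 x y h
    have e2 : marginalNoise e z 2 a.1 x = marginalNoise e z 2 a.1 y :=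
      (dependsOn_marginalNoise 2 a.1).mono (range_subset_compl_range he h2.symm) h
    have e3 : marginalNoise e z 3 a.2 x = marginalNoise e z 3 a.2 y :=
      (dependsOn_marginalNoise 3 a.2).mono (range_subset_compl_range he h3.symm) h
    simp only [η, productError, e2, e3]
  have hV : ∀ a (c : Fin 4), c ≠ 2 → c ≠ 3 → DependsOn (V a) (Set.range fun j => e (c, j))ᶜ :=
    fun a c h2 h3 x y h => by simp only [V, hη a c h2 h3 h]
  have hVsq : ∑ a, ∫ ω, V a ω ^ 2 ∂Measure.pi μ ≤ 2 * B + 2 * H := by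
    calc ∑ a, ∫ ω, V a ω ^ 2 ∂Measure.pi μ
        ≤ ∑ a, (2 * D a ^ 2 + 2 * ∫ ω, η a ω ^ 2 ∂Measure.pi μ) := by
          refine Finset.sum_le_sum fun a _ => ?_
          calc ∫ ω, V a ω ^ 2 ∂Measure.pi μ
              ≤ ∫ ω, (2 * D a ^ 2 + 2 * η a ω ^ 2) ∂Measure.pi μ := by
                refine integral_mono .of_finite .of_finite fun ω => ?_
                simp only [V]
                nlinarith [sq_nonneg (D a - η a ω)]
            _ = _ := by
                rw [integral_add .of_finite .of_finite]
                simp [integral_const_mul]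
      _ = 2 * ∑ a, D a ^ 2 + 2 * H := by
          rw [Finset.sum_add_distrib, ← Finset.mul_sum, ← Finset.mul_sum]
      _ ≤ _ := by gcongr
  have n1 : ∫ ω, (∑ a, V a ω * ξ a ω) ^ 2 ∂Measure.pi μ ≤ w * (2 * B + 2 * H) :=
    (integral_sq_sum_jointNoise_le he hz hs 0 fun a => hV a 0 (by decide) (by decide)).trans
      (mul_le_mul_of_nonneg_left hVsq hw0)
  have n2 : ∫ ω, (∑ a, V a ω * ξ' a ω) ^ 2 ∂Measure.pi μ ≤ w * (2 * B + 2 * H) :=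
    (integral_sq_sum_jointNoise_le he hz hs 1 fun a => hV a 1 (by decide) (by decide)).trans
      (mul_le_mul_of_nonneg_left hVsq hw0)
  -- The noise of kind 1 acts as the weight for that of kind 0; there are `L ^ 2` pairs, each of
  -- variance at most `w`.
  have n3 : ∫ ω, (∑ a, ξ' a ω * ξ a ω) ^ 2 ∂Measure.pi μ ≤ (L * w) ^ 2 := by
    refine (integral_sq_sum_jointNoise_le he hz hs 0 fun a => (dependsOn_jointNoise 1 a).mono
      (range_subset_compl_range he (by decide))).trans ?_
    have : ∑ a, ∫ ω, jointNoise e z 1 a ω ^ 2 ∂Measure.pi μ ≤ ∑ _a : ι × ι, w :=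
      Finset.sum_le_sum fun a _ => integral_jointNoise_sq_le he hz hs 1 a
    refine (mul_le_mul_of_nonneg_left this hw0).trans (le_of_eq ?_)
    simp only [Finset.sum_const, Finset.card_univ, Fintype.card_prod, nsmul_eq_mul, L]
    push_cast
    ring
  calc _ ≤ ∫ ω, (3 / 128 * B + 96 / B * ((∑ a, V a ω * ξ a ω) ^ 2 + (∑ a, V a ω * ξ' a ω) ^ 2 +
        (∑ a, ξ' a ω * ξ a ω) ^ 2) + 65 * ∑ a, η a ω ^ 2) ∂Measure.pi μ := by
        refine integral_mono .of_finite .of_finite fun ω => ?_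
        refine le_trans (le_of_eq ?_) (abs_sum_mul_sub_sum_sq_le D (fun a => η a ω) (fun a => ξ a ω)
          (fun a => ξ' a ω) hB0 hB)
        dsimp only
        congr 2
        refine Finset.sum_congr rfl fun a _ => ?_
        simp only [D, η, productError]
        ring
    _ = 3 / 128 * B + 96 / B * (∫ ω, (∑ a, V a ω * ξ a ω) ^ 2 ∂Measure.pi μ +
        ∫ ω, (∑ a, V a ω * ξ' a ω) ^ 2 ∂Measure.pi μ +
        ∫ ω, (∑ a, ξ' a ω * ξ a ω) ^ 2 ∂Measure.pi μ) + 65 * H := by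
        rw [integral_add .of_finite .of_finite, integral_add .of_finite .of_finite,
          integral_const_mul, integral_const_mul, integral_const_mul,
          integral_add .of_finite .of_finite, integral_add .of_finite .of_finite,
          integral_finsetSum _ fun _ _ => .of_finite]
        simp [H]
    _ ≤ 3 / 128 * B + 96 / B * (w * (2 * B + 2 * H) + w * (2 * B + 2 * H) + (L * w) ^ 2)
        + 65 * H := by gcongr
    _ ≤ B / 32 := by
        have hw : L * w ≤ B / 160000 := by linarith
        have hHB : H ≤ 9 * B / 160000 := by linarith
        have hw' : w ≤ B / 160000 := by linarith
        have h1 : w * (2 * B + 2 * H) ≤ B / 160000 * (2 * B + 2 * (9 * B / 160000)) := by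
          gcongr
        have h2 : (L * w) ^ 2 ≤ (B / 160000) ^ 2 := by gcongr
        have h3 : 96 / B * (w * (2 * B + 2 * H) + w * (2 * B + 2 * H) + (L * w) ^ 2) ≤
            96 / B * (B / 160000 * (2 * B + 2 * (9 * B / 160000)) +
              B / 160000 * (2 * B + 2 * (9 * B / 160000)) + (B / 160000) ^ 2) := by gcongr
        have h4 : 96 / B * (B / 160000 * (2 * B + 2 * (9 * B / 160000)) +
              B / 160000 * (2 * B + 2 * (9 * B / 160000)) + (B / 160000) ^ 2) =
            B * (96 * (1 / 160000 * (2 + 2 * (9 / 160000)) +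
              1 / 160000 * (2 + 2 * (9 / 160000)) + (1 / 160000) ^ 2)) := by
          field_simp
        nlinarith

end Block

/-! ### Rescaled sign bits and the block statistic -/

/-- The sign `±1` encoded by a bit. -/
def bitSign (b : Bool) : ℝ := if b then 1 else -1

lemma bitSign_sq (b : Bool) : bitSign b ^ 2 = 1 := by cases b <;> simp [bitSign]

section Moments

variable {ν : Measure Bool} [IsProbabilityMeasure ν] {τ θ : ℝ}

lemma integral_bitSign_div_sub (hτ : τ ≠ 0) (h : ∫ b, bitSign b ∂ν = τ * θ) :
    ∫ b, (bitSign b / τ - θ) ∂ν = 0 := by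
  rw [integral_sub .of_finite .of_finite, integral_div, h]
  simp only [integral_const, probReal_univ, one_smul, mul_div_cancel_left₀ _ hτ, sub_self]

lemma integral_bitSign_div_sub_sq_le (hτ : τ ≠ 0) (h : ∫ b, bitSign b ∂ν = τ * θ) :
    ∫ b, (bitSign b / τ - θ) ^ 2 ∂ν ≤ 1 / τ ^ 2 := by
  have e1 : ∀ b, (bitSign b / τ - θ) ^ 2 = 1 / τ ^ 2 + θ ^ 2 - 2 * θ / τ * bitSign b := by
    intro b
    rw [← bitSign_sq b]
    ring
  simp_rw [e1]
  rw [integral_sub .of_finite .of_finite, integral_const_mul, h]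
  have : 2 * θ / τ * (τ * θ) = 2 * θ ^ 2 := by field_simp
  rw [this]
  simp only [integral_const, probReal_univ, one_smul]
  nlinarith [sq_nonneg θ]

end Moments

section Statistic

variable {I ι : Type*} [Fintype I] [Fintype ι] {m : ℕ}

/-- The estimate of the joint coefficient at the pair of frequencies `a` by the players of
kind `c`. -/
noncomputable def jointEstimate (τ : ℝ) (y : Fin 4 × ι × ι × Fin m → Bool) (c : Fin 4)
    (a : ι × ι) : ℝ :=
  (∑ t, bitSign (y (c, a.1, a.2, t)) / τ) / m

/-- The estimate of the marginal coefficient at the frequency `a` by the players of kind `c`. -/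
noncomputable def marginalEstimate (τ : ℝ) (y : Fin 4 × ι × ι × Fin m → Bool) (c : Fin 4)
    (a : ι) : ℝ :=
  (∑ j, bitSign (y (c, a, j)) / τ) / Fintype.card (ι × Fin m)

/-- An estimate of the squared distance between the joint coefficients and the products of the
marginal coefficients. -/
noncomputable def blockStatistic (τ : ℝ) (y : Fin 4 × ι × ι × Fin m → Bool) : ℝ :=
  ∑ a : ι × ι,
    (jointEstimate τ y 0 a - marginalEstimate τ y 2 a.1 * marginalEstimate τ y 3 a.2) *
    (jointEstimate τ y 1 a - marginalEstimate τ y 2 a.1 * marginalEstimate τ y 3 a.2)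

/-- The coefficient which a player of a given role estimates. -/
def roleCoeff (P : ι × ι → ℝ) (u v : ι → ℝ) (j : Fin 4 × ι × ι × Fin m) : ℝ :=
  match j.1 with
  | 0 => P (j.2.1, j.2.2.1)
  | 1 => P (j.2.1, j.2.2.1)
  | 2 => u j.2.1
  | 3 => v j.2.1

variable {μ : I → Measure Bool} [∀ i, IsProbabilityMeasure (μ i)]
  {e : Fin 4 × ι × ι × Fin m → I} {P : ι × ι → ℝ} {u v : ι → ℝ} {τ : ℝ}

omit [Fintype I] [Fintype ι] in
lemma jointEstimate_eq [NeZero m] {c : Fin 4} (hc : c = 0 ∨ c = 1) (a : ι × ι) (ω : I → Bool) :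
    jointEstimate τ (fun j => ω (e j)) c a =
      P a + jointNoise e (fun j b => bitSign b / τ - roleCoeff P u v j) c a ω := by
  have hm0 : (m : ℝ) ≠ 0 := Nat.cast_ne_zero.2 (NeZero.ne m)
  rcases hc with rfl | rfl <;>
  · simp only [jointEstimate, jointNoise, meanNoise, roleCoeff, Finset.sum_sub_distrib,
      Finset.sum_const, Finset.card_univ, Fintype.card_fin, nsmul_eq_mul]
    field_simp
    ring

omit [Fintype I] in
lemma marginalEstimate_eq [NeZero m] [Nonempty ι] {c : Fin 4} {w : ι → ℝ}
    (hc : ∀ j, roleCoeff P u v (m := m) (c, j) = w j.1) (a : ι) (ω : I → Bool) :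
    marginalEstimate τ (fun j => ω (e j)) c a =
      w a + marginalNoise e (fun j b => bitSign b / τ - roleCoeff P u v j) c a ω := by
  have hm0 : (Fintype.card (ι × Fin m) : ℝ) ≠ 0 := Nat.cast_ne_zero.2 Fintype.card_ne_zero
  simp only [marginalEstimate, marginalNoise, meanNoise, hc, Finset.sum_sub_distrib,
    Finset.sum_const, Finset.card_univ, nsmul_eq_mul]
  field_simp
  ring

/-- Markov's inequality at level `B / 2` for an error of mean at most `B / 32`. -/
lemma measureReal_blockStatistic_le [NeZero m] [Nonempty ι] (he : e.Injective) (hτ : τ ≠ 0)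
    (hμ : ∀ j, ∫ b, bitSign b ∂μ (e j) = τ * roleCoeff P u v j)
    (hu : ∑ a, u a ^ 2 ≤ Fintype.card ι) (hv : ∑ a, v a ^ 2 ≤ Fintype.card ι)
    {g B : ℝ} (hg : 0 < g) (hg1 : g ≤ 1)
    (hm : 40000 * (Fintype.card ι * (1 / τ ^ 2 / m)) ≤ g)
    (hgB : 4 * g ≤ B) (hB : ∑ a, (P a - u a.1 * v a.2) ^ 2 ≤ B) :
    (Measure.pi μ).real {ω | B / 2 ≤ |blockStatistic τ (fun j => ω (e j)) -
      ∑ a, (P a - u a.1 * v a.2) ^ 2|} ≤ 1 / 16 := by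
  have h := integral_abs_blockStatistic_sub_le (μ := μ) (P := P) (u := u) (v := v) he
    (z := fun j b => bitSign b / τ - roleCoeff P u v j)
    (fun j => integral_bitSign_div_sub hτ (hμ j))
    (fun j => integral_bitSign_div_sub_sq_le hτ (hμ j)) (by positivity) hu hv hg hg1 hm hgB hB
  have h2 := mul_meas_ge_le_integral_of_nonneg (μ := Measure.pi μ)
    (f := fun ω => |blockStatistic τ (fun j => ω (e j)) - ∑ a, (P a - u a.1 * v a.2) ^ 2|)
    (ae_of_all _ fun ω => abs_nonneg _) .of_finite (B / 2)
  have h3 : ∀ ω : I → Bool, blockStatistic τ (fun j => ω (e j)) = _ := fun ω => by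
    simp only [blockStatistic, jointEstimate_eq (P := P) (u := u) (v := v) (Or.inl rfl),
      jointEstimate_eq (P := P) (u := u) (v := v) (Or.inr rfl),
      marginalEstimate_eq (P := P) (u := u) (v := v) (c := 2) (w := u) (fun _ => rfl),
      marginalEstimate_eq (P := P) (u := u) (v := v) (c := 3) (w := v) (fun _ => rfl)]
    rfl
  have h4 := h2.trans ((integral_congr_ae (ae_of_all _ fun ω => by
    simp only [h3])).trans_le h)
  have hB0 : 0 < B := by linarith
  have : B / 2 * (Measure.pi μ).real {ω | B / 2 ≤ |blockStatistic τ (fun j => ω (e j)) -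
      ∑ a, (P a - u a.1 * v a.2) ^ 2|} ≤ B / 2 * (1 / 16) := h4.trans (by linarith)
  exact le_of_mul_le_mul_left this (by linarith)

end Statistic

/-! ### Amplification by majority vote -/

section Majority

variable {I : Type*} [Fintype I] {μ : I → Measure Bool} [∀ i, IsProbabilityMeasure (μ i)]

open Classical in
/-- Independent events of probability at most `1 / 16` are unlikely to occur half of the time. -/
lemma measureReal_half_le {R : ℕ} {bad : Fin R → (I → Bool) → Prop} {S : Fin R → Set I}
    (hbad : ∀ r, DependsOn (bad r) (S r)) (hS : Pairwise fun i j => Disjoint (S i) (S j))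
    (hp : ∀ r, (Measure.pi μ).real {ω | bad r ω} ≤ 1 / 16) :
    (Measure.pi μ).real {ω | R ≤ 2 * (Finset.univ.filter fun r => bad r ω).card} ≤ (1 / 2) ^ R := by
  -- The product is `16 ^ #bad`; each independent factor has mean at most `1 + 15 / 16 ≤ 2`. If half
  -- the events occur, it is at least `4 ^ R`, and Markov gives `(2 / 4) ^ R`.
  have hE : ∫ ω, ∏ r : Fin R, (if bad r ω then (16 : ℝ) else 1) ∂Measure.pi μ ≤ 2 ^ R := by
    rw [integral_prod_of_dependsOn (S := S) Finset.univ
      (fun r x y h => by simp only [hbad r h]) hS]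
    calc _ ≤ ∏ _r : Fin R, (2 : ℝ) := by
          refine Finset.prod_le_prod (fun r _ => integral_nonneg fun ω => ?_) fun r _ => ?_
          · dsimp only; split_ifs <;> norm_num
          · have : ∀ ω, (if bad r ω then (16 : ℝ) else 1) =
                1 + 15 * ({ω | bad r ω}.indicator 1 ω) := by
              intro ω
              by_cases h : bad r ω
              · simp [h]; norm_num
              · simp [h]
            simp_rw [this]
            rw [integral_add .of_finite .of_finite, integral_const_mul,
              integral_indicator_one (Set.toFinite _).measurableSet]
            have := hp r
            simp only [integral_const, probReal_univ, one_smul]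
            linarith
      _ = 2 ^ R := by simp
  have h := mul_meas_ge_le_integral_of_nonneg (μ := Measure.pi μ)
    (f := fun ω => ∏ r : Fin R, (if bad r ω then (16 : ℝ) else 1))
    (ae_of_all _ fun ω => Finset.prod_nonneg fun r _ => by split_ifs <;> norm_num) .of_finite (4 ^ R)
  have hsub : {ω | R ≤ 2 * (Finset.univ.filter fun r => bad r ω).card} ⊆
      {ω | (4 : ℝ) ^ R ≤ ∏ r : Fin R, (if bad r ω then (16 : ℝ) else 1)} := by
    intro ω hω
    simp only [Set.mem_ofPred_eq] at hω ⊢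
    rw [Finset.prod_ite]
    simp only [Finset.prod_const, one_pow, mul_one]
    calc (4 : ℝ) ^ R ≤ 4 ^ (2 * (Finset.univ.filter fun r => bad r ω).card) :=
          pow_le_pow_right₀ (by norm_num) hω
      _ = _ := by rw [pow_mul]; norm_num
  have h2 : (4 : ℝ) ^ R * (Measure.pi μ).real
      {ω | R ≤ 2 * (Finset.univ.filter fun r => bad r ω).card} ≤ 2 ^ R :=
    (mul_le_mul_of_nonneg_left (measureReal_mono hsub) (by positivity)).trans (h.trans hE)
  have h3 : (4 : ℝ) ^ R * (1 / 2) ^ R = 2 ^ R := by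
    rw [← mul_pow]; norm_num
  rw [← h3] at h2
  exact le_of_mul_le_mul_left h2 (by positivity)

variable {ι : Type*} [Fintype ι] {m R : ℕ}

open Classical in
/-- The referee accepts if at least half of the blocks have a small statistic. -/
noncomputable def accepts (τ g : ℝ) (e : Fin R × Fin 4 × ι × ι × Fin m → I) (ω : I → Bool) : Bool :=
  R ≤ 2 * (Finset.univ.filter fun r => blockStatistic τ (fun j => ω (e (r, j))) < 2 * g).card

variable {e : Fin R × Fin 4 × ι × ι × Fin m → I} {P : ι × ι → ℝ} {u v : ι → ℝ} {τ g : ℝ}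

lemma measureReal_accepts_ne_le [NeZero m] [Nonempty ι] (he : e.Injective) (hτ : τ ≠ 0)
    (hμ : ∀ j, ∫ b, bitSign b ∂μ (e j) = τ * roleCoeff P u v j.2)
    (hu : ∑ a, u a ^ 2 ≤ Fintype.card ι) (hv : ∑ a, v a ^ 2 ≤ Fintype.card ι)
    (hg : 0 < g) (hg1 : g ≤ 1) (hm : 40000 * (Fintype.card ι * (1 / τ ^ 2 / m)) ≤ g)
    {verdict : Bool}
    (h : if verdict then ∑ a, (P a - u a.1 * v a.2) ^ 2 = 0
      else 4 * g ≤ ∑ a, (P a - u a.1 * v a.2) ^ 2) :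
    (Measure.pi μ).real {ω | accepts τ g e ω ≠ verdict} ≤ (1 / 2) ^ R := by
  classical
  set A := ∑ a, (P a - u a.1 * v a.2) ^ 2
  have hbad : ∀ B, 4 * g ≤ B → A ≤ B → (Measure.pi μ).real {ω | R ≤ 2 * (Finset.univ.filter
      fun r => B / 2 ≤ |blockStatistic τ (fun j => ω (e (r, j))) - A|).card} ≤ (1 / 2) ^ R := by
    intro B hgB hAB
    have hmaj := measureReal_half_le (μ := μ)
      (bad := fun r ω => B / 2 ≤ |blockStatistic τ (fun j => ω (e (r, j))) - A|)
      (S := fun r => Set.range fun j => e (r, j)) ?_ ?_ ?_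
    · convert hmaj
    · intro r x y hxy
      have : (fun j => x (e (r, j))) = fun j => y (e (r, j)) := funext fun j => hxy _ ⟨j, rfl⟩
      simp only [this]
    · intro r r' hr
      rw [Set.disjoint_left]
      rintro _ ⟨j, rfl⟩ ⟨j', hj⟩
      exact hr (congrArg Prod.fst (he hj)).symm
    · intro r
      exact measureReal_blockStatistic_le (e := fun j => e (r, j))
        (fun i j hij => by simpa using he hij) hτ (fun j => hμ (r, j)) hu hv hg hg1 hm hgB hAB
  cases verdict with
  | true =>
    simp only [if_true] at h
    -- Here `A = 0`, so a block at or above the threshold `2 * g` errs by at least `B / 2` with `B =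
    -- 4 * g`.
    refine (measureReal_mono ?_).trans (hbad (4 * g) le_rfl (by rw [h]; linarith))
    intro ω hω
    simp only [accepts, Set.mem_ofPred_eq, ne_eq, decide_eq_true_eq, not_le] at hω ⊢
    have hcard := Finset.card_filter_add_card_filter_not (s := Finset.univ)
      (fun r : Fin R => blockStatistic τ (fun j => ω (e (r, j))) < 2 * g)
    rw [Finset.card_univ, Fintype.card_fin] at hcard
    have hle : (Finset.univ.filter fun r : Fin R =>
        ¬ blockStatistic τ (fun j => ω (e (r, j))) < 2 * g).card ≤ (Finset.univ.filter
        fun r => 4 * g / 2 ≤ |blockStatistic τ (fun j => ω (e (r, j))) - A|).card := by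
      refine Finset.card_le_card fun r hr => ?_
      simp only [Finset.mem_filter, Finset.mem_univ, true_and, not_lt] at hr ⊢
      rw [h, sub_zero]
      exact le_trans (by linarith) (le_abs_self _)
    omega
  | false =>
    simp only [Bool.false_eq_true, if_false] at h
    -- With `B = A ≥ 4 * g`, a statistic below `2 * g ≤ A / 2` errs by at least `B / 2`.
    refine (measureReal_mono ?_).trans (hbad A h le_rfl)
    intro ω hω
    simp only [accepts, Set.mem_ofPred_eq, ne_eq, decide_eq_false_iff_not, not_not] at hω ⊢
    refine hω.trans (Nat.mul_le_mul_left 2 (Finset.card_le_card fun r hr => ?_))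
    simp only [Finset.mem_filter, Finset.mem_univ, true_and] at hr ⊢
    rw [abs_sub_comm]
    exact le_trans (by linarith) (le_abs_self _)

end Majority

/-! ### Orthogonal sign systems and Walsh characters -/

section Orthogonal

variable {A X : Type*} [Fintype A] [Fintype X] [DecidableEq X]

/-- The columns `h · x` are pairwise orthogonal and of squared norm `N`. -/
def OrthogonalColumns (h : A → X → ℝ) (N : ℝ) : Prop :=
  ∀ x y, ∑ a, h a x * h a y = if x = y then N else 0

/-- Parseval's identity; only the columns need be orthogonal, so restricting the characters to `k`
points is allowed. -/
lemma OrthogonalColumns.sum_sq {h : A → X → ℝ} {N : ℝ} (hh : OrthogonalColumns h N) (w : X → ℝ) :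
    ∑ a, (∑ x, w x * h a x) ^ 2 = N * ∑ x, w x ^ 2 := by
  calc ∑ a, (∑ x, w x * h a x) ^ 2 = ∑ a, ∑ x, ∑ y, w x * w y * (h a x * h a y) := by
        refine Finset.sum_congr rfl fun a _ => ?_
        rw [sq, Finset.sum_mul_sum]
        exact Finset.sum_congr rfl fun x _ => Finset.sum_congr rfl fun y _ => by ring
    _ = ∑ x, ∑ y, w x * w y * ∑ a, h a x * h a y := by
        rw [Finset.sum_comm]
        refine Finset.sum_congr rfl fun x _ => ?_
        rw [Finset.sum_comm]
        exact Finset.sum_congr rfl fun y _ => by rw [Finset.mul_sum]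
    _ = N * ∑ x, w x ^ 2 := by
        rw [Finset.mul_sum]
        refine Finset.sum_congr rfl fun x _ => ?_
        simp only [hh x, mul_ite, mul_zero, Finset.sum_ite_eq, Finset.mem_univ, if_true]
        ring

omit [Fintype X] in
lemma OrthogonalColumns.prod {B Y : Type*} [Fintype B] [DecidableEq Y] {h : A → X → ℝ} {N : ℝ}
    (hh : OrthogonalColumns h N) {h' : B → Y → ℝ} {N' : ℝ} (hh' : OrthogonalColumns h' N') :
    OrthogonalColumns (fun (a : A × B) (x : X × Y) => h a.1 x.1 * h' a.2 x.2) (N * N') := by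
  intro x y
  have : ∑ a : A × B, h a.1 x.1 * h' a.2 x.2 * (h a.1 y.1 * h' a.2 y.2) =
      (∑ a, h a x.1 * h a y.1) * ∑ b, h' b x.2 * h' b y.2 := by
    rw [Fintype.sum_prod_type, Finset.sum_mul_sum]
    exact Finset.sum_congr rfl fun a _ => Finset.sum_congr rfl fun b _ => by ring
  rw [this, hh, hh']
  by_cases h1 : x.1 = y.1 <;> by_cases h2 : x.2 = y.2 <;> simp [h1, h2, Prod.ext_iff]

/-- The characters of the group `(ℤ/2)^q`. -/
def walsh {q : ℕ} (a x : Fin q → Bool) : ℝ := ∏ i, if a i && x i then -1 else 1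

lemma abs_walsh {q : ℕ} (a x : Fin q → Bool) : |walsh a x| = 1 := by
  rw [walsh, Finset.abs_prod]
  exact Finset.prod_eq_one fun i _ => by split_ifs <;> simp

lemma sum_walsh_mul {q : ℕ} (x y : Fin q → Bool) :
    ∑ a, walsh a x * walsh a y = if x = y then 2 ^ q else 0 := by
  have h1 : ∑ a, walsh a x * walsh a y = ∏ i, ∑ b : Bool,
      ((if b && x i then -1 else 1) * (if b && y i then -1 else 1) : ℝ) := by
    rw [← Finset.sum_prod_piFinset, Fintype.piFinset_univ]
    simp only [walsh, Finset.prod_mul_distrib]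
  have h2 : ∀ i, ∑ b : Bool,
      ((if b && x i then -1 else 1) * (if b && y i then -1 else 1) : ℝ) =
        if x i = y i then 2 else 0 := by
    intro i
    cases x i <;> cases y i <;> norm_num
  rw [h1]
  simp only [h2]
  split_ifs with h
  · simp [h]
  · obtain ⟨i, hi⟩ := Function.ne_iff.1 h
    exact Finset.prod_eq_zero (Finset.mem_univ i) (if_neg hi)

end Orthogonal

/-! ### From distance to coefficients -/

section Coefficients

variable {ι : Type*} [Fintype ι] {k : ℕ} {h : ι → Fin k → ℝ}
  {p : Measure (Fin k × Fin k)} [IsProbabilityMeasure p]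

/-- The coefficients of a distribution with respect to the functions `h a`. -/
noncomputable def coeff {X A : Type*} [Fintype X] [MeasurableSpace X] (p : Measure X) (h : A → X → ℝ) (a : A) :
    ℝ :=
  ∑ x, p.real {x} * h a x

omit [Fintype ι] in
lemma coeff_fst (a : ι) : coeff p.fst h a = coeff p (fun a x => h a x.1) a := by
  have h1 : ∫ x, h a x ∂p.fst = ∫ x, h a x.1 ∂p :=
    integral_map measurable_fst.aemeasurable Integrable.of_finite.aestronglyMeasurable
  rw [integral_fintype .of_finite, integral_fintype .of_finite] at h1
  exact h1

omit [Fintype ι] in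
lemma coeff_snd (a : ι) : coeff p.snd h a = coeff p (fun a x => h a x.2) a := by
  have h1 : ∫ x, h a x ∂p.snd = ∫ x, h a x.2 ∂p :=
    integral_map measurable_snd.aemeasurable Integrable.of_finite.aestronglyMeasurable
  rw [integral_fintype .of_finite, integral_fintype .of_finite] at h1
  exact h1

lemma sum_coeff_sq_le {N : ℝ} (hN : 0 ≤ N) (hh : OrthogonalColumns h N) (r : Measure (Fin k))
    [IsProbabilityMeasure r] : ∑ a, coeff r h a ^ 2 ≤ N := by
  simp only [coeff]
  rw [hh.sum_sq]
  refine mul_le_of_le_one_right hN ?_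
  calc ∑ x, r.real {x} ^ 2 ≤ ∑ x, r.real {x} := Finset.sum_le_sum fun x _ => by
        have h0 : 0 ≤ r.real {x} := measureReal_nonneg
        have h1 : r.real {x} ≤ 1 := measureReal_le_one
        nlinarith
    _ = 1 := by
      rw [sum_measureReal_singleton]
      simp

lemma sum_coeff_sub_sq {N : ℝ} (hh : OrthogonalColumns h N) :
    ∑ a : ι × ι, (coeff p (fun a x => h a.1 x.1 * h a.2 x.2) a -
        coeff p (fun a x => h a x.1) a.1 * coeff p (fun a x => h a x.2) a.2) ^ 2 =
      N * N * ∑ x, (p.real {x} - (p.fst.prod p.snd).real {x}) ^ 2 := by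
  rw [← (hh.prod hh).sum_sq]
  refine Finset.sum_congr rfl fun a _ => ?_
  congr 1
  rw [← coeff_fst, ← coeff_snd]
  simp only [coeff, sub_mul, Finset.sum_sub_distrib]
  congr 1
  rw [Finset.sum_mul_sum, Fintype.sum_prod_type]
  refine Finset.sum_congr rfl fun x _ => Finset.sum_congr rfl fun y _ => ?_
  rw [← Set.singleton_prod_singleton, measureReal_prod_prod]
  ring

lemma distToProducts_le : distToProducts k p ≤ tvDist p (p.fst.prod p.snd) := by
  refine ciInf_le (f := fun q : ProbabilityMeasure (Fin k) × ProbabilityMeasure (Fin k) =>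
    tvDist p ((q.1 : Measure (Fin k)).prod (q.2 : Measure (Fin k)))) ⟨0, ?_⟩
    (⟨p.fst, inferInstance⟩, ⟨p.snd, inferInstance⟩)
  rintro _ ⟨q, rfl⟩
  exact mul_nonneg (by norm_num) (Finset.sum_nonneg fun _ _ => abs_nonneg _)

/-- The product of the marginals of `p` is one competitor in the infimum, so the `ℓ₁` distance to it
exceeds `2 * ε`; Cauchy-Schwarz over `k ^ 2` points passes to `ℓ₂`. -/
lemma four_mul_sq_le_of_lt_distToProducts {ε N : ℝ} (hε : 0 < ε) (hkN : (k : ℝ) ≤ N)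
    (hp : ε < distToProducts k p) :
    4 * ε ^ 2 ≤ N * N * ∑ x, (p.real {x} - (p.fst.prod p.snd).real {x}) ^ 2 := by
  have h1 := hp.trans_le distToProducts_le
  rw [tvDist] at h1
  set w : Fin k × Fin k → ℝ := fun x => p.real {x} - (p.fst.prod p.snd).real {x}
  have h2 : (∑ x, |w x|) ^ 2 ≤ ((k : ℝ) * k) * ∑ x, w x ^ 2 := by
    have := sq_sum_le_card_mul_sum_sq (s := Finset.univ) (f := fun x => |w x|)
    simpa using this
  have h3 : 2 * ε ≤ ∑ x, |w x| := by
    change ε < 1 / 2 * ∑ x, |w x| at h1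
    linarith
  have h4 : (2 * ε) ^ 2 ≤ (∑ x, |w x|) ^ 2 := by gcongr
  have h5 : ((k : ℝ) * k) * ∑ x, w x ^ 2 ≤ N * N * ∑ x, w x ^ 2 := by
    have : 0 ≤ ∑ x, w x ^ 2 := Finset.sum_nonneg fun _ _ => sq_nonneg _
    have hk : (0 : ℝ) ≤ k := Nat.cast_nonneg k
    gcongr
    linarith
  linarith

end Coefficients

/-! ### The private one-bit protocol -/

section Protocol

/-- The law of a bit whose sign has mean `t`. -/
noncomputable def biasedBit (t : ℝ) : Measure Bool :=
  ENNReal.ofReal ((1 + t) / 2) • Measure.dirac true +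
    ENNReal.ofReal ((1 - t) / 2) • Measure.dirac false

lemma biasedBit_singleton (t : ℝ) (b : Bool) :
    biasedBit t {b} = ENNReal.ofReal ((1 + bitSign b * t) / 2) := by
  cases b <;> simp [biasedBit, bitSign, sub_eq_add_neg]

lemma isProbabilityMeasure_biasedBit {t : ℝ} (ht : |t| ≤ 1) :
    IsProbabilityMeasure (biasedBit t) := by
  obtain ⟨h1, h2⟩ := abs_le.1 ht
  constructor
  simp only [biasedBit, Measure.add_apply, Measure.smul_apply, measure_univ, smul_eq_mul, mul_one]
  rw [← ENNReal.ofReal_add (by linarith) (by linarith)]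
  norm_num
  ring

lemma integral_biasedBit {t : ℝ} (ht : |t| ≤ 1) : ∫ b, bitSign b ∂biasedBit t = t := by
  have := isProbabilityMeasure_biasedBit ht
  obtain ⟨h1, h2⟩ := abs_le.1 ht
  rw [integral_fintype .of_finite, Fintype.sum_bool, measureReal_def, measureReal_def,
    biasedBit_singleton, biasedBit_singleton]
  simp only [bitSign, if_true, Bool.false_eq_true, if_false, smul_eq_mul]
  rw [ENNReal.toReal_ofReal (by linarith), ENNReal.toReal_ofReal (by linarith)]
  ring

variable {X : Type} [Fintype X] [MeasurableSpace X] [MeasurableSingletonClass X] {n : ℕ}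

/-- The protocol in which player `i` sends a bit whose sign has mean `τ * f i x` on sample `x`. -/
noncomputable def signProtocol (τ : ℝ) (f : Fin n → X → ℝ) (hf : ∀ i x, |τ * f i x| ≤ 1) :
    PrivateCoinProtocol X Bool n where
  -- No seed is needed: the index of a player fixes its role, and all randomness lies in the
  -- channel.
  Seed _ := Unit
  seedSpace _ := inferInstance
  seedLaw _ := Measure.dirac ()
  seedLaw_prob _ := inferInstance
  channel i := Kernel.ofFunOfCountable fun s => biasedBit (τ * f i s.2)
  channel_markov i := ⟨fun s => isProbabilityMeasure_biasedBit (hf i s.2)⟩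

/-- The likelihood ratio is at most `(1 + ρ / 4) / (1 - ρ / 4) ≤ 1 + ρ ≤ exp ρ` for `ρ ≤ 1`. -/
lemma isLDP_signProtocol {ρ : ℝ} (hρ : 0 < ρ) (hρ1 : ρ ≤ 1) {f : Fin n → X → ℝ}
    (hf : ∀ i x, |f i x| ≤ 1) (hf' : ∀ i x, |ρ / 4 * f i x| ≤ 1) :
    (signProtocol (ρ / 4) f hf').IsLDP ρ := by
  intro i _ y x x'
  change biasedBit (ρ / 4 * f i x') {y} ≤
    ENNReal.ofReal (Real.exp ρ) * biasedBit (ρ / 4 * f i x) {y}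
  rw [biasedBit_singleton, biasedBit_singleton, ← ENNReal.ofReal_mul (Real.exp_pos ρ).le]
  refine ENNReal.ofReal_le_ofReal ?_
  have hb : ∀ x, |bitSign y * (ρ / 4 * f i x)| ≤ ρ / 4 := by
    intro x
    have : |bitSign y| = 1 := by cases y <;> simp [bitSign]
    rw [abs_mul, abs_mul, this, one_mul, abs_of_pos (by positivity : 0 < ρ / 4)]
    exact mul_le_of_le_one_right (by positivity) (hf i x)
  have h1 := (abs_le.1 (hb x')).2
  have h2 := (abs_le.1 (hb x)).1
  have h3 : (1 + ρ) * ((1 - ρ / 4) / 2) ≤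
      Real.exp ρ * ((1 + bitSign y * (ρ / 4 * f i x)) / 2) := by
    have := Real.add_one_le_exp ρ
    gcongr <;> linarith
  nlinarith

lemma dirac_prod_bind_apply_singleton (p : Measure X) [IsProbabilityMeasure p]
    (κ : Kernel (Unit × X) Bool) (b : Bool) :
    ((Measure.dirac ()).prod p).bind κ {b} = ∑ x, κ ((), x) {b} * p {x} := by
  rw [Measure.dirac_prod, Measure.bind_apply (measurableSet_singleton b)
    (Kernel.aemeasurable _), lintegral_map (Kernel.measurable_coe _ (measurableSet_singleton b))
    measurable_prodMk_left, lintegral_fintype]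

lemma integral_bitSign_messageLaw {τ : ℝ} {f : Fin n → X → ℝ} (hf : ∀ i x, |τ * f i x| ≤ 1)
    (p : Measure X) [IsProbabilityMeasure p] (i : Fin n) :
    ∫ b, bitSign b ∂(signProtocol τ f hf).messageLaw p i = τ * coeff p f i := by
  have h1 : ∀ b, ((signProtocol τ f hf).messageLaw p i).real {b} =
      ∑ x, p.real {x} * (biasedBit (τ * f i x)).real {b} := by
    intro b
    have : (signProtocol τ f hf).messageLaw p i {b} =
        ∑ x, biasedBit (τ * f i x) {b} * p {x} := by
      exact dirac_prod_bind_apply_singleton p ((signProtocol τ f hf).channel i) b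
    rw [measureReal_def, this, ENNReal.toReal_sum]
    · exact Finset.sum_congr rfl fun x _ => by rw [ENNReal.toReal_mul, mul_comm]; rfl
    · intro x _
      have := isProbabilityMeasure_biasedBit (hf i x)
      exact ENNReal.mul_ne_top (measure_ne_top _ _) (measure_ne_top _ _)
  rw [integral_fintype .of_finite]
  simp only [h1, coeff, Finset.mul_sum, Finset.sum_mul, smul_eq_mul]
  rw [Finset.sum_comm]
  refine Finset.sum_congr rfl fun x _ => ?_
  have := isProbabilityMeasure_biasedBit (hf i x)
  have h2 := integral_biasedBit (hf i x)
  rw [integral_fintype .of_finite] at h2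
  simp only [smul_eq_mul] at h2
  calc _ = p.real {x} * ∑ b, (biasedBit (τ * f i x)).real {b} * bitSign b := by
        rw [Finset.mul_sum]
        exact Finset.sum_congr rfl fun b _ => by ring
    _ = _ := by rw [h2]; ring

omit [Fintype X] [MeasurableSingletonClass X] in
lemma verdictLaw_deterministic {Y : Type} [MeasurableSpace Y] (π : PrivateCoinProtocol X Y n)
    {t : (Fin n → Y) → Bool} (ht : Measurable t) (p : Measure X) [IsProbabilityMeasure p]
    (b : Bool) :
    (π.verdictLaw (Kernel.deterministic t ht) p).real {b} =
      1 - (π.transcriptLaw p).real {y | t y ≠ b} := by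
  have hs : MeasurableSet {y | t y ≠ b} := ht (measurableSet_singleton b).compl
  rw [← probReal_compl_eq_one_sub hs, PrivateCoinProtocol.verdictLaw, Measure.deterministic_comp_eq_map,
    map_measureReal_apply ht (measurableSet_singleton b)]
  congr 1
  ext y
  simp

end Protocol

/-! ### Assembly and choice of parameters -/

/-- The function of the sample which a player of a given role reports. -/
def roleFunction {ι X : Type*} {m : ℕ} (h : ι → X → ℝ) (j : Fin 4 × ι × ι × Fin m) (x : X × X) :
    ℝ :=
  roleCoeff (fun a : ι × ι => h a.1 x.1 * h a.2 x.2) (fun a => h a x.1) (fun a => h a x.2) j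

lemma abs_roleFunction_le {ι X : Type*} {m : ℕ} {h : ι → X → ℝ} (hh : ∀ a x, |h a x| ≤ 1)
    (j : Fin 4 × ι × ι × Fin m) (x : X × X) : |roleFunction h j x| ≤ 1 := by
  obtain ⟨c, a, b, t⟩ := j
  have h2 : |h a x.1 * h b x.2| ≤ 1 := by
    rw [abs_mul]
    exact mul_le_one₀ (hh a x.1) (abs_nonneg _) (hh b x.2)
  fin_cases c
  · exact h2
  · exact h2
  · exact hh a x.1
  · exact hh a x.2

lemma coeff_roleFunction {ι : Type*} {k m : ℕ} (h : ι → Fin k → ℝ) (p : Measure (Fin k × Fin k))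
    (j : Fin 4 × ι × ι × Fin m) :
    coeff p (roleFunction h) j =
      roleCoeff (coeff p fun (a : ι × ι) x => h a.1 x.1 * h a.2 x.2)
        (coeff p fun a x => h a x.1) (coeff p fun a x => h a x.2) j := by
  obtain ⟨c, a, b, t⟩ := j
  fin_cases c <;> rfl

/-- A block design over an orthogonal system of sign functions solves independence testing. -/
lemma exists_protocol {ι : Type*} [Fintype ι] [Nonempty ι] {k m R : ℕ} [NeZero m]
    {h : ι → Fin k → ℝ} (hh : ∀ a x, |h a x| ≤ 1)
    (horth : OrthogonalColumns h (Fintype.card ι)) (hk : k ≤ Fintype.card ι)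
    {ρ ε δ : ℝ} (hρ : 0 < ρ) (hρ1 : ρ ≤ 1) (hε : 0 < ε) (hε1 : ε ≤ 1)
    (hm : 40000 * (Fintype.card ι * (1 / (ρ / 4) ^ 2 / m)) ≤ ε ^ 2) (hR : (1 / 2) ^ R < δ) :
    ∃ (π : PrivateCoinProtocol (Fin k × Fin k) Bool
        (Fintype.card (Fin R × Fin 4 × ι × ι × Fin m)))
      (T : Kernel (Fin (Fintype.card (Fin R × Fin 4 × ι × ι × Fin m)) → Bool) Bool),
      IsMarkovKernel T ∧ π.IsLDP ρ ∧ SolvesIndependenceTesting k ε δ π T := by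
  let E := Fintype.equivFin (Fin R × Fin 4 × ι × ι × Fin m)
  let f : Fin (Fintype.card (Fin R × Fin 4 × ι × ι × Fin m)) → Fin k × Fin k → ℝ :=
    fun i => roleFunction h (E.symm i).2
  have hf : ∀ i x, |f i x| ≤ 1 := fun i x => abs_roleFunction_le hh _ x
  have hf' : ∀ i x, |ρ / 4 * f i x| ≤ 1 := by
    intro i x
    rw [abs_mul, abs_of_pos (by positivity)]
    exact mul_le_one₀ (by linarith) (abs_nonneg _) (hf i x)
  let π := signProtocol (ρ / 4) f hf'
  let t := accepts (ρ / 4) (ε ^ 2) E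
  have ht : Measurable t := Measurable.of_discrete
  refine ⟨π, Kernel.deterministic t ht, inferInstance, isLDP_signProtocol hρ hρ1 hf hf', ?_⟩
  intro p _
  have key : ∀ verdict : Bool,
      (if verdict then ∑ a : ι × ι, (coeff p (fun a x => h a.1 x.1 * h a.2 x.2) a -
        coeff p (fun a x => h a x.1) a.1 * coeff p (fun a x => h a x.2) a.2) ^ 2 = 0
      else 4 * ε ^ 2 ≤ ∑ a : ι × ι, (coeff p (fun a x => h a.1 x.1 * h a.2 x.2) a -
        coeff p (fun a x => h a x.1) a.1 * coeff p (fun a x => h a x.2) a.2) ^ 2) →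
      1 - δ < (π.verdictLaw (Kernel.deterministic t ht) p).real {verdict} := by
    intro verdict hv
    rw [verdictLaw_deterministic]
    have := measureReal_accepts_ne_le (μ := fun i => π.messageLaw p i) (e := E) E.injective
      (τ := ρ / 4) (by positivity) (fun j => by
        rw [integral_bitSign_messageLaw, ← coeff_roleFunction]
        simp only [coeff, f, Equiv.symm_apply_apply])
      (by
        simp only [← coeff_fst]
        exact sum_coeff_sq_le (Nat.cast_nonneg _) horth p.fst)
      (by
        simp only [← coeff_snd]
        exact sum_coeff_sq_le (Nat.cast_nonneg _) horth p.snd)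
      (by positivity) (pow_le_one₀ hε.le hε1) hm hv
    have h2 := this.trans_lt hR
    change 1 - δ < 1 - (Measure.pi fun i => π.messageLaw p i).real {y | t y ≠ verdict}
    linarith
  rw [sum_coeff_sub_sq horth] at key
  constructor
  · intro hp
    refine key true ?_
    rw [← hp]
    simp
  · intro hp
    refine key false ?_
    simpa using four_mul_sq_le_of_lt_distToProducts hε (by exact_mod_cast hk) hp

/-- As `δ` tends to 1 the allowed number of players tends to 0, so large `δ` is treated apart: a
fair coin with no players succeeds with probability `1 / 2 > 1 - δ`. -/
lemma exists_protocol_of_half_lt {k : ℕ} {ρ ε δ : ℝ} (hδ : 1 / 2 < δ) :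
    ∃ (π : PrivateCoinProtocol (Fin k × Fin k) Bool 0) (T : Kernel (Fin 0 → Bool) Bool),
      IsMarkovKernel T ∧ π.IsLDP ρ ∧ SolvesIndependenceTesting k ε δ π T := by
  have := isProbabilityMeasure_biasedBit (t := 0) (by simp)
  refine ⟨signProtocol 0 (fun _ _ => 0) (by simp), Kernel.const _ (biasedBit 0), inferInstance,
    fun i => i.elim0, ?_⟩
  intro p _
  have h : ∀ b, ((signProtocol 0 (fun _ _ => 0) (by simp)).verdictLaw
      (Kernel.const (Fin 0 → Bool) (biasedBit 0)) p).real {b} = 1 / 2 := by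
    intro b
    rw [PrivateCoinProtocol.verdictLaw, Measure.const_comp, measure_univ, one_smul,
      measureReal_def, biasedBit_singleton]
    simp
  simp only [h]
  constructor <;> intro _ <;> linarith

lemma exists_repetitions {δ : ℝ} (hδ : 0 < δ) (hδ2 : δ ≤ 1 / 2) :
    ∃ R : ℕ, (1 / 2 : ℝ) ^ R < δ ∧ (R : ℝ) ≤ 4 * Real.log (1 / δ) := by
  have hlog2 : 1 / 2 ≤ Real.log 2 := by linarith [Real.log_two_gt_d9]
  have hlog : Real.log 2 ≤ Real.log (1 / δ) := by
    refine Real.log_le_log (by norm_num) ?_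
    rw [le_div_iff₀ hδ]
    linarith
  have hx : 0 ≤ Real.log (1 / δ) / Real.log 2 := by
    apply div_nonneg <;> linarith
  -- The `+ 1` makes the inequality strict and costs at most `2 * log (1 / δ)`, because `log (1 / δ)
  -- ≥ log 2 ≥ 1 / 2`.
  refine ⟨⌊Real.log (1 / δ) / Real.log 2⌋₊ + 1, ?_, ?_⟩
  · have h1 := Nat.lt_floor_add_one (Real.log (1 / δ) / Real.log 2)
    rw [div_lt_iff₀ (by linarith)] at h1
    rw [one_div, inv_pow, inv_lt_comm₀ (by positivity) hδ, ← one_div,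
      ← Real.log_lt_log_iff (by positivity) (by positivity), Real.log_pow]
    exact_mod_cast h1
  · have h1 := Nat.floor_le hx
    have h2 : Real.log (1 / δ) / Real.log 2 ≤ 2 * Real.log (1 / δ) := by
      rw [div_le_iff₀ (by linarith)]
      nlinarith
    push_cast
    linarith

lemma exists_orthogonalColumns {k : ℕ} (hk : 1 ≤ k) :
    ∃ (q : ℕ) (h : (Fin q → Bool) → Fin k → ℝ), k ≤ 2 ^ q ∧ 2 ^ q ≤ 2 * k ∧
      (∀ a x, |h a x| ≤ 1) ∧ OrthogonalColumns h (2 ^ q) := by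
  have h1 := Nat.lt_pow_succ_log_self (b := 2) (by norm_num) k
  have h2 := Nat.pow_log_le_self 2 (x := k) (by omega)
  obtain ⟨F⟩ : Nonempty (Fin k ↪ (Fin (Nat.log 2 k + 1) → Bool)) := by
    apply Function.Embedding.nonempty_of_card_le
    simpa using h1.le
  refine ⟨Nat.log 2 k + 1, fun a x => walsh a (F x), h1.le, ?_,
    fun a x => (abs_walsh a (F x)).le, fun x y => ?_⟩
  · rw [pow_succ]; omega
  · rw [sum_walsh_mul]
    simp only [F.injective.eq_iff]

end LDPTesting

theorem mainTheorem5 :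
    ∃ C : ℝ, 0 < C ∧
      ∀ (k : ℕ) (ρ ε δ : ℝ), 1 ≤ k → 0 < ρ → ρ ≤ 1 → 0 < ε → ε ≤ 1 → 0 < δ → δ < 1 →
        ∃ n : ℕ, (n : ℝ) ≤ C * ((k : ℝ) ^ 3 / (ε ^ 2 * ρ ^ 2) * Real.log (1 / δ)) ∧
          ∃ (π : LDPTesting.PrivateCoinProtocol (Fin k × Fin k) Bool n)
            (T : ProbabilityTheory.Kernel (Fin n → Bool) Bool),
            ProbabilityTheory.IsMarkovKernel T ∧ π.IsLDP ρ ∧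
              LDPTesting.SolvesIndependenceTesting k ε δ π T := by
  -- The count below gives `4 * 4 * 640001 * 2 ^ 3 = 81920128`.
  refine ⟨10 ^ 8, by norm_num, ?_⟩
  intro k ρ ε δ hk hρ hρ1 hε hε1 hδ hδ1
  rcases lt_or_ge (1 / 2) δ with hδ2 | hδ2
  · refine ⟨0, ?_, LDPTesting.exists_protocol_of_half_lt hδ2⟩
    have : 0 ≤ Real.log (1 / δ) := Real.log_nonneg (by rw [le_div_iff₀ hδ]; linarith)
    rw [Nat.cast_zero]
    positivity
  obtain ⟨R, hR, hRle⟩ := LDPTesting.exists_repetitions hδ hδ2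
  obtain ⟨q, h, hkq, hqk, hh, horth⟩ := LDPTesting.exists_orthogonalColumns hk
  have hcard : (Fintype.card (Fin q → Bool) : ℝ) = 2 ^ q := by simp
  set L : ℝ := 2 ^ q
  have hL1 : 1 ≤ L := one_le_pow₀ (by norm_num)
  have hLk : L ≤ 2 * k := by
    simp only [L]
    exact_mod_cast hqk
  set x : ℝ := L / (ρ ^ 2 * ε ^ 2)
  have hρε : ρ ^ 2 * ε ^ 2 ≤ 1 :=
    mul_le_one₀ (pow_le_one₀ hρ.le hρ1) (by positivity) (pow_le_one₀ hε.le hε1)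
  have hx1 : 1 ≤ x := by
    rw [one_le_div (by positivity)]
    linarith
  -- `640000 = 40000 * 16`, the factor 16 coming from `1 / (ρ / 4) ^ 2`; rounding up costs at most
  -- `x` since `x ≥ 1`.
  set m : ℕ := ⌈640000 * x⌉₊
  have hm1 : 640000 * x ≤ m := Nat.le_ceil _
  have hm2 : (m : ℝ) ≤ 640001 * x := by
    have := Nat.ceil_lt_add_one (a := 640000 * x) (by positivity)
    linarith
  have hm0 : (0 : ℝ) < m := by linarith
  have : NeZero m := ⟨by rintro h0; rw [h0] at hm0; simp at hm0⟩
  refine ⟨_, ?_, LDPTesting.exists_protocol (m := m) (R := R) hh (hcard ▸ horth) (by simpa using hkq)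
    hρ hρ1 hε hε1 ?_ hR⟩
  · have hn : ((Fintype.card (Fin R × Fin 4 × (Fin q → Bool) × (Fin q → Bool) × Fin m) : ℕ) : ℝ) =
        R * (4 * (L * (L * m))) := by
      simp [L]
    rw [hn]
    have hlog : 0 ≤ Real.log (1 / δ) := by
      have : (0 : ℝ) ≤ R := Nat.cast_nonneg R
      linarith
    calc R * (4 * (L * (L * m)))
        ≤ (4 * Real.log (1 / δ)) * (4 * (L * (L * (640001 * x)))) := by gcongr
      _ = 10240016 * (L ^ 3 / (ρ ^ 2 * ε ^ 2) * Real.log (1 / δ)) := by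
          simp only [x]; ring
      _ ≤ 10240016 * ((2 * k) ^ 3 / (ρ ^ 2 * ε ^ 2) * Real.log (1 / δ)) := by gcongr
      _ = 81920128 * (k ^ 3 / (ε ^ 2 * ρ ^ 2) * Real.log (1 / δ)) := by ring
      _ ≤ 10 ^ 8 * (k ^ 3 / (ε ^ 2 * ρ ^ 2) * Real.log (1 / δ)) := by gcongr; norm_num
  · rw [hcard]
    have : 40000 * (L * (1 / (ρ / 4) ^ 2 / m)) = ε ^ 2 * (640000 * x / m) := by
      simp only [x]
      field_simp
      norm_num
    rw [this]
    exact mul_le_of_le_one_right (by positivity) ((div_le_one hm0).2 hm1)
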